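/- Let $G$ be a compact topological group, let $E$ and $B$ be $G$-spaces (topological spaces with a continuous action of $G$), and let $p : E \to B$ be a continuous equivariant map. Call a continuous equivariant map $q : E' \to B'$ of $G$-spaces a Hurewicz $G$-fibration if for every $G$-space $X$ and all continuous equivariant maps $f : X \to E'$ and $F : X \times [0,1] \to B'$ with $F(x,0) = q(f(x))$ for all $x \in X$ (where $G$ acts trivially on $[0,1]$), there is a continuous equivariant map $\tilde F : X \times [0,1] \to E'$ with $q \circ \tilde F = F$ and $\tilde F(x,0) = f(x)$ for all $x \in X$. Let $\{U_i\}_{i \in \mathcal I}$ be a locally finite cover of $B$ by open invariant subsets which is normal, that is, for every $i$ there is a continuous function $\chi_i : B \to [0,1]$ with $\chi_i(gb) = \chi_i(b)$ for all $g \in G$, $b \in B$, and $U_i = \{b \in B \mid \chi_i(b) \neq 0\}$. If for every $i \in \mathcal I$ the restriction $p|_{p^{-1}(U_i)} : p^{-1}(U_i) \to U_i$ is a Hurewicz $G$-fibration, then $p$ is a Hurewicz $G$-fibration. -/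

import Mathlib

open scoped unitInterval

universe w uG uE uB uι

/-- A map of `G`-spaces: continuous and equivariant. -/
structure IsGMap (G : Type uG) {X : Type uE} {Y : Type uB} [TopologicalSpace X] [TopologicalSpace Y]
    [SMul G X] [SMul G Y] (f : X → Y) : Prop where
  continuous : Continuous f
  map_smul : ∀ (g : G) (x : X), f (g • x) = g • f x

/-- A continuous equivariant map `X × I → Y`, where `G` acts on `X × I` by `g (x, t) = (g x, t)`. -/
structure IsGHomotopy (G : Type uG) {X : Type uE} {Y : Type uB} [TopologicalSpace X]
    [TopologicalSpace Y] [SMul G X] [SMul G Y] (F : X × I → Y) : Prop where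
  continuous : Continuous F
  map_smul : ∀ (g : G) (x : X) (t : I), F (g • x, t) = g • F (x, t)

/-- The property of equivariant covering homotopy of `p : E → B` with respect to `X`. -/
def HasEquivariantCoveringHomotopy (G : Type uG) {E : Type uE} {B : Type uB}
    [TopologicalSpace E] [TopologicalSpace B] [SMul G E] [SMul G B] (p : E → B)
    (X : Type w) [TopologicalSpace X] [SMul G X] : Prop :=
  ∀ (f : X → E) (F : X × I → B), IsGMap G f → IsGHomotopy G F →
    (∀ x : X, F (x, 0) = p (f x)) →
    ∃ F' : X × I → E, IsGHomotopy G F' ∧ (∀ z : X × I, p (F' z) = F z) ∧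
      ∀ x : X, F' (x, 0) = f x

/-- `p : E → B` is a Hurewicz `G`-fibration: a `G`-map with the property of equivariant covering
homotopy with respect to every `G`-space `X` (in the universe `w`). -/
structure IsHurewiczGFibration (G : Type uG) [Group G] [TopologicalSpace G]
    {E : Type uE} {B : Type uB} [TopologicalSpace E] [TopologicalSpace B]
    [MulAction G E] [MulAction G B] (p : E → B) : Prop where
  isGMap : IsGMap G p
  lift : ∀ (X : Type w) [TopologicalSpace X] [MulAction G X] [ContinuousSMul G X],
    HasEquivariantCoveringHomotopy G p X

/-- The invariant subset `p⁻¹(U)` of `E`, for an invariant subset `U` of `B`. With its subspace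
topology and the restricted action it is a `G`-space. -/
def invariantPreimage {G : Type uG} {E : Type uE} {B : Type uB} [TopologicalSpace E]
    [TopologicalSpace B] [SMul G E] [SMul G B] {p : E → B} (hp : IsGMap G p)
    (U : SubMulAction G B) : SubMulAction G E where
  carrier := p ⁻¹' (U : Set B)
  smul_mem' := fun g x hx => by
    rw [Set.mem_preimage, hp.map_smul]
    exact U.smul_mem g hx

/-- The restriction `p⁻¹(U) → U` of a `G`-map `p`. -/
def restrictOver {G : Type uG} {E : Type uE} {B : Type uB} [TopologicalSpace E]
    [TopologicalSpace B] [SMul G E] [SMul G B] {p : E → B} (hp : IsGMap G p)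
    (U : SubMulAction G B) (e : invariantPreimage hp U) : U :=
  ⟨p e.1, e.2⟩

/-- A family of invariant subsets of `X` is a `G`-cover if the sets are open and cover `X`. -/
structure IsGCover {G : Type uG} {X : Type uB} [TopologicalSpace X] [SMul G X] {ι : Type uι}
    (U : ι → SubMulAction G X) : Prop where
  isOpen : ∀ i, IsOpen (U i : Set X)
  covers : ∀ x : X, ∃ i, x ∈ U i

/-- A normal `G`-cover: every member has a characteristic `G`-function, that is, an invariant
continuous function `X → [0, 1]` whose non-vanishing set is that member. -/
structure IsNormalGCover {G : Type uG} {X : Type uB} [TopologicalSpace X] [SMul G X] {ι : Type uι}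
    (U : ι → SubMulAction G X) : Prop extends IsGCover U where
  exists_char : ∀ i, ∃ χ : C(X, I), (∀ (g : G) (x : X), χ (g • x) = χ x) ∧
    (U i : Set X) = {x | χ x ≠ 0}

/-! Over each `U i` the hypothesis is used only once, to obtain an equivariant path lifting function
`Λ i` (`IsHurewiczGFibration.exists_isLiftingFunction`).

Suppose first that each path F(x, ·) stays in some `U i`. The minima of χ_i ∘ F over {x} × I yield a
partition of unity u_i on X whose supports lie in the open sets {x | F({x} × I) ⊆ U_i}. For each x,
cut [0,1] into consecutive intervals of lengths u_i(x) and lift over the i-th one by `Λ i`. Locally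
only finitely many intervals are nondegenerate, so the lift is continuous
(`exists_lift_of_partition`).

In general, a continuous Lebesgue number δ on X (`exists_continuous_lebesgue`) cuts F into time
slices of length δ(x), each short in the above sense. They are lifted in turn, each starting where
the previous lift ends, and glued (`exists_lift_of_timeSlice`).

Both u_i and δ depend on x only through the numbers χ_i(F(x, t)); hence they are G-invariant and the
lifts are equivariant. -/

open Set Function Filter Topology

/-! ### Minima over compact slices, partitions of unity, Lebesgue numbers -/

theorem exists_continuous_min_of_compact {Y K : Type*} [TopologicalSpace Y] [TopologicalSpace K]
    [CompactSpace K] [Nonempty K] {h : Y × K → ℝ} (hc : Continuous h) :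
    ∃ m : Y → ℝ, Continuous m ∧ (∀ y s, m y ≤ h (y, s)) ∧ (∀ y, ∃ s, h (y, s) = m y) ∧
      ∀ y y', (∀ s, h (y, s) = h (y', s)) → m y = m y' := by
  have hmin : ∀ y, ∃ s, ∀ s', h (y, s) ≤ h (y, s') := fun y => by
    obtain ⟨s, -, hs⟩ := isCompact_univ.exists_isMinOn univ_nonempty
      (f := fun s : K => h (y, s)) (by fun_prop)
    exact ⟨s, fun s' => hs (mem_univ s')⟩
  choose s hs using hmin
  refine ⟨fun y => h (y, s y), ?_, hs, fun y => ⟨s y, rfl⟩,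
    fun y y' h => le_antisymm ((hs y _).trans_eq (h _)) ((hs y' _).trans_eq (h _).symm)⟩
  have key : (fun y => h (y, s y)) = fun y => sInf ((fun k => h (y, k)) '' univ) := by
    funext y
    refine Eq.symm (IsLeast.csInf_eq (a := h (y, s y)) ⟨⟨s y, mem_univ _, rfl⟩, ?_⟩)
    rintro _ ⟨k, -, rfl⟩
    exact hs y k
  rw [key]
  exact isCompact_univ.continuous_sInf (f := fun y k => h (y, k)) hc

/-- The minima of a locally finite family of functions along the slices `{y} × I`. -/
theorem exists_slice_min {ι Y : Type*} [TopologicalSpace Y] {ψ : ι → Y × I → ℝ}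
    (hc : ∀ i, Continuous (ψ i)) (h0 : ∀ i z, 0 ≤ ψ i z)
    (hlf : LocallyFinite fun i => support (ψ i)) :
    ∃ m : ι → Y → ℝ, (∀ i, Continuous (m i)) ∧ (∀ i y, 0 ≤ m i y) ∧
      (LocallyFinite fun i => support (m i)) ∧ (∀ i y, 0 < m i y ↔ ∀ s, 0 < ψ i (y, s)) ∧
      ∀ y y', (∀ i s, ψ i (y, s) = ψ i (y', s)) → ∀ i, m i y = m i y' := by
  choose m hm hle hex hinv using fun i => exists_continuous_min_of_compact (hc i)
  have hpos : ∀ i y, 0 ≤ m i y := fun i y => by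
    obtain ⟨s, hs⟩ := hex i y
    exact hs ▸ h0 i _
  refine ⟨m, hm, hpos, ?_, fun i y => ⟨fun h s => h.trans_le (hle i y s), fun h => ?_⟩,
    fun y y' h i => hinv i y y' (h i)⟩
  · refine (hlf.preimage_continuous (g := fun y : Y => (y, (0 : I))) (by fun_prop)).subset ?_
    intro i y hy
    exact ((lt_of_le_of_ne (hpos i y) (Ne.symm hy)).trans_le (hle i y 0)).ne'
  · obtain ⟨s, hs⟩ := hex i y
    exact hs ▸ h s

/-- A locally finite family of nonnegative functions without common zeros can be turned into a
partition of unity subordinate to the open sets where these functions are positive. -/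
theorem exists_partition_subordinate {ι X : Type*} [TopologicalSpace X] {m : ι → X → ℝ}
    (hc : ∀ i, Continuous (m i)) (h0 : ∀ i x, 0 ≤ m i x)
    (hlf : LocallyFinite fun i => support (m i)) (hcov : ∀ x, ∃ i, 0 < m i x) :
    ∃ u : ι → X → ℝ, (∀ i, Continuous (u i)) ∧ (∀ i x, 0 ≤ u i x) ∧
      (LocallyFinite fun i => support (u i)) ∧ (∀ x, ∑ᶠ i, u i x = 1) ∧
      (∀ i, tsupport (u i) ⊆ {x | 0 < m i x}) ∧
      ∀ x x', (∀ i, m i x = m i x') → ∀ i, u i x = u i x' := by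
  have fin : ∀ {f : ι → X → ℝ}, (∀ i, support (f i) ⊆ support (m i)) → ∀ x,
      (support fun i => f i x).Finite := fun {f} hf x =>
    (hlf.point_finite x).subset fun i hi => hf i hi
  have spos : ∀ {f : ι → X → ℝ}, (∀ i, support (f i) ⊆ support (m i)) → (∀ i x, 0 ≤ f i x) →
      (∀ x, ∃ i, 0 < f i x) → ∀ x, 0 < ∑ᶠ i, f i x := fun {f} hf hf0 hfe x => by
    obtain ⟨i, hi⟩ := hfe x
    exact hi.trans_le (single_le_finsum i (fin hf x) fun j => hf0 j x)
  have hsq : ∀ i, support (fun x => m i x ^ 2) ⊆ support (m i) := fun i x hx => by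
    simpa using hx
  have hM := continuous_finsum hc hlf
  have hQ := continuous_finsum (fun i => (hc i).pow 2) (hlf.subset hsq)
  have hMpos := spos (fun i => subset_rfl) h0 hcov
  have hQpos := spos hsq (fun i x => sq_nonneg _) fun x =>
    (hcov x).imp fun i hi => pow_pos hi 2
  set M : X → ℝ := fun x => ∑ᶠ i, m i x with hMdef
  set Q : X → ℝ := fun x => ∑ᶠ i, m i x ^ 2 with hQdef
  have hMne : ∀ x, 2 * M x ≠ 0 := fun x => (mul_pos two_pos (hMpos x)).ne'
  -- Half the mean of the `m i x` weighted by themselves: a continuous positive threshold that some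
  -- `m i x` exceeds. Truncating at `c` puts the support of `v i` into the closed set `c ≤ m i`,
  -- inside `0 < m i`.
  set c : X → ℝ := fun x => Q x / (2 * M x) with hcdef
  have hcc : Continuous c := hQ.div (continuous_const.mul hM) hMne
  have hcpos : ∀ x, 0 < c x := fun x => div_pos (hQpos x) (mul_pos two_pos (hMpos x))
  set v : ι → X → ℝ := fun i x => max 0 (m i x - c x) with hvdef
  have hvc : ∀ i, Continuous (v i) := fun i => continuous_const.max ((hc i).sub hcc)
  have hv0 : ∀ i x, 0 ≤ v i x := fun i x => le_max_left _ _
  have hvs : ∀ i, support (v i) ⊆ {x | c x ≤ m i x} := fun i x hx => by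
    by_contra h
    simp only [mem_ofPred_eq, not_le] at h
    exact hx (max_eq_left (by linarith))
  have hvsupp : ∀ i, support (v i) ⊆ support (m i) := fun i x hx =>
    ((hcpos x).trans_le (hvs i hx)).ne'
  have hvex : ∀ x, ∃ i, 0 < v i x := fun x => by
    by_contra! h
    have hle : ∀ i, m i x ≤ c x := fun i => by
      have := (le_max_right 0 (m i x - c x)).trans (h i)
      linarith
    have h1 : Q x ≤ ∑ᶠ i, c x * m i x := by
      refine finsum_le_finsum' (fin hsq x) (fin (f := fun i x => c x * m i x) (fun i y hy => ?_) x)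
        fun i => ?_
      · exact right_ne_zero_of_mul hy
      · rw [sq]
        exact mul_le_mul_of_nonneg_right (hle i) (h0 i x)
    rw [← mul_finsum] at h1
    have h2 : c x * M x = Q x / 2 := by
      have : M x ≠ 0 := (hMpos x).ne'
      simp only [hcdef]
      field_simp
    have h3 := hQpos x
    have h4 : Q x ≤ c x * M x := h1
    linarith
  have hV := continuous_finsum hvc (hlf.subset hvsupp)
  have hVpos := spos hvsupp hv0 hvex
  have husupp : ∀ i, support (fun x => v i x / ∑ᶠ j, v j x) ⊆ support (v i) := fun i x hx hv =>
    hx (by simp only [hv, zero_div])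
  refine ⟨fun i x => v i x / ∑ᶠ j, v j x, fun i => (hvc i).div hV fun x => (hVpos x).ne',
    fun i x => div_nonneg (hv0 i x) (hVpos x).le, hlf.subset fun i => (husupp i).trans (hvsupp i),
    fun x => ?_, fun i => ?_, fun x x' h i => ?_⟩
  · simp only [div_eq_mul_inv]
    rw [← finsum_mul, mul_inv_cancel₀ (hVpos x).ne']
  · refine (closure_minimal ((husupp i).trans (hvs i)) (isClosed_le hcc (hc i))).trans ?_
    exact fun x hx => (hcpos x).trans_le hx
  · simp only [hvdef, hcdef, hQdef, hMdef, h]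

/-- A Lebesgue number for the slices `{x} × I`, depending continuously on `x`. -/
theorem exists_continuous_lebesgue {ι X : Type*} [TopologicalSpace X] {ψ : ι → X × I → ℝ}
    (hc : ∀ i, Continuous (ψ i)) (h0 : ∀ i z, 0 ≤ ψ i z)
    (hlf : LocallyFinite fun i => support (ψ i)) (hcov : ∀ z, ∃ i, 0 < ψ i z) :
    ∃ δ : X → ℝ, Continuous δ ∧ (∀ x, 0 < δ x) ∧
      (∀ x (t : I), ∃ i, ∀ s : ℝ, 0 ≤ s → s ≤ δ x →
        0 < ψ i (x, projIcc 0 1 zero_le_one (t + s))) ∧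
      ∀ x x', (∀ i t, ψ i (x, t) = ψ i (x', t)) → δ x = δ x' := by
  -- For fixed `((x, d), t)`, varying the last coordinate sweeps out the clamped interval from `t`
  -- to `t + d` over `x`.
  let e : ((X × I) × I) × I → X × I := fun z =>
    (z.1.1.1, projIcc 0 1 zero_le_one ((z.1.2 : ℝ) + z.2 * z.1.1.2))
  have he : Continuous e := by
    have := continuous_projIcc (a := (0 : ℝ)) (b := 1) (h := zero_le_one)
    fun_prop
  obtain ⟨k, hkc, hk0, hklf, hkpos, hkinv⟩ := exists_slice_min (ψ := fun i z => ψ i (e z))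
    (fun i => (hc i).comp he) (fun i z => h0 i _) (hlf.preimage_continuous he)
  have hKc := continuous_finsum hkc hklf
  -- `M (x, d)` is positive iff each such interval of length `d` over `x` lies in the positivity set
  -- of a single `ψ i`.
  obtain ⟨M, hMc, hMle, hMex, hMinv⟩ := exists_continuous_min_of_compact hKc
  -- `-D x` is the maximum over `d` of `min d (M (x, d))`. A maximizing `d` satisfies `-D x ≤ d` and
  -- `0 < M (x, d)`, so the length `-D x` is admissible.
  obtain ⟨D, hDc, hDle, hDex, hDinv⟩ := exists_continuous_min_of_compact
    (h := fun z : X × I => -min (z.2 : ℝ) (M z)) (by fun_prop)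
  have hδ : ∀ x, 0 < -D x := fun x => by
    -- Intervals of length 0 are points, so `hcov` suffices; positivity then persists for small `d >
    -- 0`.
    have hM0 : 0 < M (x, 0) := by
      obtain ⟨t, ht⟩ := hMex (x, 0)
      rw [← ht]
      obtain ⟨i, hi⟩ := hcov (x, t)
      have : 0 < k i ((x, 0), t) := by
        rw [hkpos]
        intro s
        simpa [e] using hi
      exact this.trans_le (single_le_finsum i (hklf.point_finite _) fun j => hk0 j _)
    have hev : ∀ᶠ d : I in 𝓝 0, 0 < M (x, d) :=
      (by fun_prop : Continuous fun d : I => M (x, d)).continuousAt.eventually_const_lt hM0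
    have : ∃ d : I, 0 < d ∧ 0 < M (x, d) := by
      have : (𝓝[Ioi (0 : I)] 0).NeBot := nhdsGT_neBot_of_exists_gt ⟨1, zero_lt_one⟩
      have h' : ∀ᶠ d in 𝓝[Ioi (0 : I)] 0, d ∈ Ioi (0 : I) ∧ 0 < M (x, d) :=
        (eventually_mem_nhdsWithin).and (hev.filter_mono nhdsWithin_le_nhds)
      exact h'.exists
    obtain ⟨d, hd, hMd⟩ := this
    have h1 := hDle x d
    have h2 : 0 < min (d : ℝ) (M (x, d)) := lt_min hd hMd
    linarith
  refine ⟨fun x => -D x, hDc.neg, hδ, fun x t => ?_, fun x x' h => ?_⟩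
  · obtain ⟨d, hd⟩ := hDex x
    have hmin : min (d : ℝ) (M (x, d)) = -D x := by linarith
    have hdle : -D x ≤ d := hmin ▸ min_le_left _ _
    have hMpos : 0 < M (x, d) := (hδ x).trans_le (hmin ▸ min_le_right _ _)
    have hd0 : (0 : ℝ) < d := (hδ x).trans_le hdle
    obtain ⟨i, hi⟩ : ∃ i, k i ((x, d), t) ≠ 0 := by
      by_contra! h
      exact (hMpos.trans_le (hMle (x, d) t)).ne' (by simp only [h, finsum_zero])
    refine ⟨i, fun s hs hsδ => ?_⟩
    have := (hkpos i _).1 (lt_of_le_of_ne (hk0 i _) (Ne.symm hi))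
      ⟨s / d, div_nonneg hs hd0.le, (div_le_one hd0).2 (hsδ.trans hdle)⟩
    simpa only [e, div_mul_cancel₀ _ hd0.ne'] using this
  · refine congrArg Neg.neg (hDinv x x' fun d => ?_)
    have : M (x, d) = M (x', d) := hMinv _ _ fun t =>
      finsum_congr fun i => hkinv _ _ (fun j s => h j _) i
    simp only [this]

/-! ### Equivariant path lifting functions -/

section LiftingFunction

variable {G : Type uG} {E : Type uE} {B : Type uB} [TopologicalSpace E] [TopologicalSpace B]

/-- The pairs of a point `e` and a path in `U` starting at `p e`. -/
def pathPairs (p : E → B) (U : Set B) : Set (E × C(I, B)) :=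
  {z | p z.1 = z.2 0 ∧ ∀ t, z.2 t ∈ U}

/-- An equivariant path lifting function for `p` over the invariant subset `U`. -/
structure IsLiftingFunction (G : Type uG) [SMul G E] [SMul G B] (p : E → B) (U : Set B)
    (Λ : (E × C(I, B)) × I → E) : Prop where
  continuousOn : ContinuousOn Λ (pathPairs p U ×ˢ univ)
  map_eq : ∀ z ∈ pathPairs p U, ∀ t, p (Λ (z, t)) = z.2 t
  map_zero : ∀ z ∈ pathPairs p U, Λ (z, 0) = z.1
  map_smul : ∀ z ∈ pathPairs p U, ∀ z' : E × C(I, B), ∀ g : G, z'.1 = g • z.1 →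
    (∀ t, z'.2 t = g • z.2 t) → ∀ t, Λ (z', t) = g • Λ (z, t)

/-- The pairs (e, ω) form the universal test space: lift the evaluation homotopy ((e, ω), t) ↦ ω(t)
with initial map (e, ω) ↦ e. This space lives in the universe `max uE uB`. -/
theorem IsHurewiczGFibration.exists_isLiftingFunction [Group G] [TopologicalSpace G]
    [MulAction G E] [ContinuousSMul G E] [MulAction G B] [ContinuousSMul G B]
    {p : E → B} {hp : IsGMap G p} {U : SubMulAction G B}
    (h : IsHurewiczGFibration.{max uE uB} G (restrictOver hp U)) :
    ∃ Λ, IsLiftingFunction G p (U : Set B) Λ := by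
  classical
  let W : SubMulAction G (E × C(I, B)) :=
    { carrier := pathPairs p U
      smul_mem' := fun g z hz => by
        refine ⟨?_, fun t => U.smul_mem g (hz.2 t)⟩
        change p (g • z.1) = g • z.2 0
        rw [hp.map_smul, hz.1] }
  have hW0 : ∀ z : W, p z.1.1 ∈ U := fun z => by
    rw [z.2.1]
    exact z.2.2 0
  have : ContinuousSMul G W :=
    ⟨Continuous.subtype_mk (by fun_prop : Continuous fun q : G × W => q.1 • (q.2 : E × C(I, B))) _⟩
  obtain ⟨L, hL, hLp, hL0⟩ := h.lift W (fun z => ⟨z.1.1, hW0 z⟩)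
    (fun q => ⟨q.1.1.2 q.2, q.1.2.2 q.2⟩)
    ⟨by fun_prop, fun g z => rfl⟩ ⟨by fun_prop, fun g z t => rfl⟩
    (fun z => Subtype.ext z.2.1.symm)
  -- The value outside `W` is immaterial.
  refine ⟨fun q => if hq : q.1 ∈ W then L (⟨q.1, hq⟩, q.2) else q.1.1, ?_, fun z hz t => ?_,
    fun z hz => ?_, fun z hz z' g h1 h2 t => ?_⟩
  · rw [continuousOn_iff_continuous_domRestrict]
    have : Continuous fun q : (pathPairs p (U : Set B) ×ˢ (univ : Set I) : Set _) =>
        (L (⟨q.1.1, q.2.1⟩, q.1.2) : E) :=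
      continuous_subtype_val.comp (hL.continuous.comp (by fun_prop))
    refine this.congr fun q => ?_
    have hq : q.1.1 ∈ W := q.2.1
    simp only [domRestrict_apply, hq, dite_true]
  · have hz' : z ∈ W := hz
    simp only [hz', dite_true]
    exact congrArg Subtype.val (hLp (⟨z, hz⟩, t))
  · have hz' : z ∈ W := hz
    simp only [hz', dite_true]
    exact congrArg Subtype.val (hL0 ⟨z, hz⟩)
  · have hz' : z ∈ W := hz
    obtain rfl : z' = g • z := Prod.ext h1 (ContinuousMap.ext h2)
    have hgz : g • z ∈ W := W.smul_mem g hz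
    simp only [hz', hgz, dite_true]
    exact congrArg Subtype.val (hL.map_smul g ⟨z, hz⟩ t)

end LiftingFunction

/-! ### Lifting along a partition of unity -/

section Sweep

set_option linter.unusedSectionVars false

variable {G : Type uG} {E : Type uE} {B : Type uB} {X : Type w} {ι : Type uι}
  [TopologicalSpace E] [TopologicalSpace B] [TopologicalSpace X]

/-- The path `s ↦ F (x, a + s)`, where the time is clamped to the unit interval. -/
noncomputable def pathFrom (F : C(X × I, B)) : C(X × ℝ, C(I, B)) :=
  ContinuousMap.curry ⟨fun q : (X × ℝ) × I => F (q.1.1, projIcc 0 1 zero_le_one (q.1.2 + q.2)), by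
    have := continuous_projIcc (a := (0 : ℝ)) (b := 1) (h := zero_le_one)
    fun_prop⟩

theorem pathFrom_apply (F : C(X × I, B)) (x : X) (a : ℝ) (s : I) :
    pathFrom F (x, a) s = F (x, projIcc 0 1 zero_le_one (a + s)) := rfl

/-- The time reached after lifting for the time `u i x` for every `i` in the list. -/
noncomputable def reach (u : ι → X → ℝ) (l : List ι) (x : X) : ℝ := (l.map fun i => u i x).sum

theorem reach_cons (u : ι → X → ℝ) (i : ι) (l : List ι) (x : X) :
    reach u (i :: l) x = u i x + reach u l x := by simp [reach]

open Classical in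
/-- The lift obtained by following, for every `i` in the list (the last one first), the lifting
function `Λ i` for the time `u i x`. -/
noncomputable def sweep (F : C(X × I, B)) (f : X → E) (u : ι → X → ℝ) (U : ι → Set B)
    (Λ : ι → (E × C(I, B)) × I → E) : List ι → X × ℝ → E
  | [], z => f z.1
  | i :: l, z =>
    if z.2 ≤ reach u l z.1 ∨ ¬ ∀ t, F (z.1, t) ∈ U i then sweep F f u U Λ l z
    else Λ i ((sweep F f u U Λ l (z.1, reach u l z.1), pathFrom F (z.1, reach u l z.1)),
      projIcc 0 1 zero_le_one (min (z.2 - reach u l z.1) (u i z.1)))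

variable {F : C(X × I, B)} {f : X → E} {u : ι → X → ℝ} {U : ι → Set B}
  {Λ : ι → (E × C(I, B)) × I → E} {p : E → B}

theorem reach_nonneg (h0 : ∀ i x, 0 ≤ u i x) (l : List ι) (x : X) : 0 ≤ reach u l x :=
  List.sum_nonneg fun a ha => by
    obtain ⟨i, -, rfl⟩ := List.mem_map.1 ha
    exact h0 i x

theorem continuous_reach (hc : ∀ i, Continuous (u i)) (l : List ι) : Continuous (reach u l) :=
  continuous_list_sum l fun i _ => hc i

theorem sweep_cons_of_le {i : ι} {l : List ι} {x : X} {r : ℝ} (h : r ≤ reach u l x) :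
    sweep F f u U Λ (i :: l) (x, r) = sweep F f u U Λ l (x, r) := by
  rw [sweep, if_pos (Or.inl h)]

theorem sweep_cons_of_notMem {i : ι} {l : List ι} {x : X} {r : ℝ} (h : ¬ ∀ t, F (x, t) ∈ U i) :
    sweep F f u U Λ (i :: l) (x, r) = sweep F f u U Λ l (x, r) := by
  rw [sweep, if_pos (Or.inr h)]

theorem sweep_cons_of_lt {i : ι} {l : List ι} {x : X} {r : ℝ} (h : reach u l x < r)
    (hx : ∀ t, F (x, t) ∈ U i) :
    sweep F f u U Λ (i :: l) (x, r) =
      Λ i ((sweep F f u U Λ l (x, reach u l x), pathFrom F (x, reach u l x)),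
        projIcc 0 1 zero_le_one (min (r - reach u l x) (u i x))) := by
  rw [sweep, if_neg (by simp only [not_or, not_le, not_not]; exact ⟨h, hx⟩)]

/-- The properties of a partial lift up to the time `τ`, constant afterwards. -/
structure IsPartialLift (G : Type uG) [SMul G E] [SMul G X] (p : E → B) (F : C(X × I, B))
    (f : X → E) (τ : X → ℝ) (L : X × ℝ → E) : Prop where
  continuous : Continuous L
  map_eq : ∀ x r, p (L (x, r)) = F (x, projIcc 0 1 zero_le_one (min r (τ x)))
  const : ∀ x r, τ x ≤ r → L (x, r) = L (x, τ x)
  initial : ∀ x, L (x, 0) = f x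
  map_smul : ∀ (g : G) x r, L (g • x, r) = g • L (x, r)

variable [SMul G E] [SMul G B] [SMul G X]

theorem IsPartialLift.mem_pathPairs {τ : X → ℝ} {L : X × ℝ → E} (hL : IsPartialLift G p F f τ L)
    {V : Set B} {x : X} (hx : ∀ t, F (x, t) ∈ V) :
    (L (x, τ x), pathFrom F (x, τ x)) ∈ pathPairs p V := by
  refine ⟨?_, fun t => hx _⟩
  rw [hL.map_eq, pathFrom_apply]
  simp

/-- Following `Λ i` for time zero changes nothing, by `map_zero`. Hence vanishing indices can be
dropped. -/
theorem sweep_cons_of_eq_zero {i : ι} {l : List ι} (hΛ : IsLiftingFunction G p (U i) (Λ i))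
    (hL : IsPartialLift G p F f (reach u l) (sweep F f u U Λ l)) {x : X} (hx : u i x = 0) (r : ℝ) :
    sweep F f u U Λ (i :: l) (x, r) = sweep F f u U Λ l (x, r) := by
  by_cases hV : ∀ t, F (x, t) ∈ U i
  · rcases le_or_gt r (reach u l x) with h | h
    · exact sweep_cons_of_le h
    · rw [sweep_cons_of_lt h hV, hx, min_eq_right (by linarith), projIcc_left]
      rw [hL.const x r h.le]
      exact hΛ.map_zero _ (hL.mem_pathPairs hV)
  · exact sweep_cons_of_notMem hV

/-- Continuity is the delicate point. Where F({x} × I) ⊆ U_i, an open condition, the two branches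
agree at `r = reach u l x` because `Λ i` starts at the given point. Any other `x` lies off `tsupport
(u i)`, and near it the index `i` has no effect. -/
theorem isPartialLift_sweep (hΛ : ∀ i, IsLiftingFunction G p (U i) (Λ i))
    (hf : IsGMap G f) (hF : IsGHomotopy G F) (h0 : ∀ x, F (x, 0) = p (f x))
    (hU : ∀ i (g : G) b, g • b ∈ U i ↔ b ∈ U i)
    (huc : ∀ i, Continuous (u i)) (hu0 : ∀ i x, 0 ≤ u i x) (hu1 : ∀ i x, u i x ≤ 1)
    (hug : ∀ i (g : G) x, u i (g • x) = u i x)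
    (hV : ∀ i, IsOpen {x | ∀ t, F (x, t) ∈ U i})
    (hsupp : ∀ i, tsupport (u i) ⊆ {x | ∀ t, F (x, t) ∈ U i}) (l : List ι) :
    IsPartialLift G p F f (reach u l) (sweep F f u U Λ l) := by
  induction l with
  | nil =>
    refine ⟨hf.continuous.comp continuous_fst, fun x r => ?_, fun x r _ => rfl, fun x => rfl,
      fun g x r => hf.map_smul g x⟩
    rw [projIcc_of_le_left _ (by simp [reach])]
    exact (h0 x).symm
  | cons i l ih =>
    have hreach := continuous_reach huc l
    have hrg : ∀ (g : G) x, reach u l (g • x) = reach u l x := fun g x => by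
      simp only [reach, hug]
    refine ⟨continuous_iff_continuousAt.2 ?_, fun x r => ?_, fun x r hr => ?_, fun x => ?_,
      fun g x r => ?_⟩
    · rintro ⟨x, r⟩
      by_cases hx : ∀ t, F (x, t) ∈ U i
      · let V := {x | ∀ t, F (x, t) ∈ U i}
        have hcont : Continuous fun z : V × ℝ => if z.2 ≤ reach u l z.1 then
            sweep F f u U Λ l (z.1, z.2) else
            Λ i ((sweep F f u U Λ l (z.1, reach u l z.1), pathFrom F (z.1, reach u l z.1)),
              projIcc 0 1 zero_le_one (min (z.2 - reach u l z.1) (u i z.1))) := by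
          have hu := huc i
          have hs := ih.continuous
          refine Continuous.if_le (by fun_prop) ?_ (by fun_prop) (by fun_prop) ?_
          · refine (hΛ i).continuousOn.comp_continuous ?_ fun z => ⟨ih.mem_pathPairs z.1.2, trivial⟩
            have := continuous_projIcc (a := (0 : ℝ)) (b := 1) (h := zero_le_one)
            fun_prop
          · rintro ⟨x, r⟩ hz
            dsimp only at hz ⊢
            rw [projIcc_of_le_left _ (min_le_of_left_le (by linarith)), hz]
            exact ((hΛ i).map_zero _ (ih.mem_pathPairs x.2)).symm
        have hemb : IsOpenEmbedding (Prod.map (Subtype.val : V → X) (id : ℝ → ℝ)) :=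
          (hV i).isOpenEmbedding_subtypeVal.prodMap .id
        refine (hemb.continuousAt_iff (x := (⟨x, hx⟩, r))).1 ?_
        refine (hcont.congr ?_).continuousAt
        rintro ⟨y, s⟩
        simp only [comp_apply, Prod.map, id]
        split_ifs with h
        · exact (sweep_cons_of_le h).symm
        · exact (sweep_cons_of_lt (not_le.1 h) y.2).symm
      · have hx' : x ∈ (tsupport (u i))ᶜ := fun h => hx (hsupp i h)
        refine ih.continuous.continuousAt.congr ?_
        filter_upwards [((isClosed_tsupport (u i)).isOpen_compl.preimage continuous_fst).mem_nhds
          (show (x, r) ∈ Prod.fst ⁻¹' (tsupport (u i))ᶜ from hx')] with z hz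
        exact (sweep_cons_of_eq_zero (hΛ i) ih (image_eq_zero_of_notMem_tsupport hz) z.2).symm
    · by_cases hx : ∀ t, F (x, t) ∈ U i
      · rcases le_or_gt r (reach u l x) with h | h
        · rw [sweep_cons_of_le h, ih.map_eq, min_eq_left h, min_eq_left]
          rw [reach_cons]
          linarith [hu0 i x]
        · rw [sweep_cons_of_lt h hx, (hΛ i).map_eq _ (ih.mem_pathPairs hx), pathFrom_apply,
            projIcc_of_mem _ ⟨le_min (by linarith) (hu0 i x), min_le_of_right_le (hu1 i x)⟩]
          congr 3
          dsimp only
          rw [reach_cons, ← min_add_add_left]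
          congr 1 <;> ring
      · have hux : u i x = 0 := by
          by_contra h
          exact hx (hsupp i (subset_tsupport _ h))
        rw [sweep_cons_of_notMem hx, ih.map_eq, reach_cons, hux, zero_add]
    · by_cases hux : u i x = 0
      · rw [sweep_cons_of_eq_zero (hΛ i) ih hux, sweep_cons_of_eq_zero (hΛ i) ih hux, reach_cons, hux,
          zero_add]
        rw [reach_cons, hux, zero_add] at hr
        exact ih.const x r hr
      · have hx := hsupp i (subset_tsupport _ hux)
        have hpos : 0 < u i x := lt_of_le_of_ne (hu0 i x) (Ne.symm hux)
        rw [reach_cons] at hr ⊢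
        rw [sweep_cons_of_lt (by linarith) hx, sweep_cons_of_lt (by linarith) hx,
          min_eq_right (by linarith), min_eq_right (by linarith)]
    · rw [sweep_cons_of_le (reach_nonneg hu0 l x), ih.initial]
    · have hiff : (∀ t, F (g • x, t) ∈ U i) ↔ ∀ t, F (x, t) ∈ U i := by
        simp only [hF.map_smul, hU]
      by_cases hx : ∀ t, F (x, t) ∈ U i
      · rcases le_or_gt r (reach u l x) with h | h
        · rw [sweep_cons_of_le h, sweep_cons_of_le (by rwa [hrg]), ih.map_smul]
        · rw [sweep_cons_of_lt h hx, sweep_cons_of_lt (by rwa [hrg]) (hiff.2 hx), hug, hrg]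
          refine (hΛ i).map_smul _ (ih.mem_pathPairs hx) _ g (ih.map_smul g x _) (fun t => ?_) _
          exact hF.map_smul g x _
      · rw [sweep_cons_of_notMem hx, sweep_cons_of_notMem (mt hiff.1 hx), ih.map_smul]

/-- This allows the list adapted to `x` to be exchanged for a longer one that serves a whole
neighbourhood. -/
theorem sweep_filter (hΛ : ∀ i, IsLiftingFunction G p (U i) (Λ i))
    (hL : ∀ l, IsPartialLift G p F f (reach u l) (sweep F f u U Λ l)) (x : X) (P : ι → Prop)
    [DecidablePred P] (hP : ∀ i, ¬ P i → u i x = 0) (l : List ι) :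
    reach u (l.filter P) x = reach u l x ∧
      ∀ r, sweep F f u U Λ (l.filter P) (x, r) = sweep F f u U Λ l (x, r) := by
  induction l with
  | nil => exact ⟨rfl, fun r => rfl⟩
  | cons i l ih =>
    by_cases hi : P i
    · rw [List.filter_cons_of_pos (by simpa using hi)]
      refine ⟨by rw [reach_cons, reach_cons, ih.1], fun r => ?_⟩
      simp only [sweep, ih.1, ih.2]
      congr 1
      rw [ih.1]
    · rw [List.filter_cons_of_neg (by simpa using hi)]
      refine ⟨by rw [reach_cons, ih.1, hP i hi, zero_add], fun r => ?_⟩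
      rw [ih.2, sweep_cons_of_eq_zero (hΛ i) (hL l) (hP i hi)]

/-- The sorted list of indices with `u i x ≠ 0` jumps with `x`, but near a given point all these
lists are filtered from one finite list sorted by the same global order, so the lift agrees there
with a single continuous `sweep`. The lengths sum to 1, so all of `F` is lifted. -/
theorem exists_lift_of_partition (hΛ : ∀ i, IsLiftingFunction G p (U i) (Λ i))
    (hf : IsGMap G f) (hF : IsGHomotopy G F) (h0 : ∀ x, F (x, 0) = p (f x))
    (hU : ∀ i (g : G) b, g • b ∈ U i ↔ b ∈ U i)
    (huc : ∀ i, Continuous (u i)) (hu0 : ∀ i x, 0 ≤ u i x)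
    (hlf : LocallyFinite fun i => support (u i)) (husum : ∀ x, ∑ᶠ i, u i x = 1)
    (hug : ∀ i (g : G) x, u i (g • x) = u i x)
    (hV : ∀ i, IsOpen {x | ∀ t, F (x, t) ∈ U i})
    (hsupp : ∀ i, tsupport (u i) ⊆ {x | ∀ t, F (x, t) ∈ U i}) :
    ∃ L : X × I → E, IsGHomotopy G L ∧ (∀ z, p (L z) = F z) ∧ ∀ x, L (x, 0) = f x := by
  classical
  let _ : LinearOrder ι := linearOrderOfSTO WellOrderingRel
  have hfin : ∀ x, (support fun i => u i x).Finite := fun x => hlf.point_finite x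
  have hu1 : ∀ i x, u i x ≤ 1 := fun i x =>
    (single_le_finsum i (hfin x) fun j => hu0 j x).trans_eq (husum x)
  have hL := isPartialLift_sweep hΛ hf hF h0 hU huc hu0 hu1 hug hV hsupp
  let idx : X → List ι := fun x => (hfin x).toFinset.sort
  have hidx : ∀ x (T : Finset ι), (∀ i, u i x ≠ 0 → i ∈ T) → ∀ r,
      sweep F f u U Λ (idx x) (x, r) = sweep F f u U Λ T.sort (x, r) := fun x T hT r => by
    have hfil : idx x = T.sort.filter fun i => u i x ≠ 0 := by
      have hnd : (T.sort.filter fun i => u i x ≠ 0).Nodup := (T.sort_nodup _).filter _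
      have hs := (List.toFinset_sort (r := (· ≤ ·)) hnd).2 ((T.pairwise_sort _).filter _)
      rw [← hs]
      refine congrArg (fun S : Finset ι => S.sort) ?_
      ext i
      simpa using hT i
    rw [hfil]
    exact (sweep_filter hΛ hL x (fun i => u i x ≠ 0) (fun i hi => not_not.1 hi) T.sort).2 r
  have hreach : ∀ x, reach u (idx x) x = 1 := fun x => by
    rw [reach, ← List.sum_toFinset _ (Finset.sort_nodup _ _), Finset.sort_toFinset, ← husum x]
    exact (finsum_eq_sum_of_support_subset _ (by simp)).symm
  refine ⟨fun z => sweep F f u U Λ (idx z.1) (z.1, z.2), ⟨continuous_iff_continuousAt.2 ?_, ?_⟩,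
    ?_, fun x => (hL _).initial x⟩
  · rintro ⟨x, t⟩
    obtain ⟨N, hN, hNfin⟩ := hlf x
    have hc : Continuous fun z : X × I => sweep F f u U Λ hNfin.toFinset.sort (z.1, (z.2 : ℝ)) :=
      (hL _).continuous.comp (by fun_prop)
    refine hc.continuousAt.congr ?_
    filter_upwards [continuous_fst.continuousAt.preimage_mem_nhds hN] with z hz
    exact (hidx z.1 _ (fun i hi => by simpa using ⟨z.1, hi, hz⟩) _).symm
  · intro g x t
    have : idx (g • x) = idx x := by simp only [idx, hug]
    simp only [this, (hL _).map_smul]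
  · rintro ⟨x, t⟩
    dsimp only
    rw [(hL _).map_eq, hreach, min_eq_left t.2.2, projIcc_val]

end Sweep

/-! ### Short homotopies and concatenation of time slices -/

section Concatenation

variable {G : Type uG} {E : Type uE} {B : Type uB} {X : Type w} {ι : Type uι}
  [TopologicalSpace E] [TopologicalSpace B] [TopologicalSpace X]

/-- A homotopy whose slices each lie in a single `U i` can be lifted. -/
theorem exists_lift_of_short [SMul G E] [SMul G B] [SMul G X] {p : E → B} {U : ι → Set B}
    {Λ : ι → (E × C(I, B)) × I → E} {χ : ι → C(B, I)} {F : X × I → B} {f : X → E}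
    (hΛ : ∀ i, IsLiftingFunction G p (U i) (Λ i)) (hχg : ∀ i (g : G) b, χ i (g • b) = χ i b)
    (hχ : ∀ i, U i = {b | χ i b ≠ 0}) (hlf : LocallyFinite U)
    (hf : IsGMap G f) (hF : IsGHomotopy G F) (h0 : ∀ x, F (x, 0) = p (f x))
    (hshort : ∀ x, ∃ i, ∀ t, F (x, t) ∈ U i) :
    ∃ L : X × I → E, IsGHomotopy G L ∧ (∀ z, p (L z) = F z) ∧ ∀ x, L (x, 0) = f x := by
  have hFc := hF.continuous
  have hmem : ∀ i z, (0 : ℝ) < χ i (F z) ↔ F z ∈ U i := fun i z => by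
    rw [hχ, mem_ofPred_eq, ← unitInterval.pos_iff_ne_zero]
    exact Iff.rfl
  obtain ⟨m, hmc, hm0, hmlf, hmpos, hminv⟩ := exists_slice_min (ψ := fun i z => (χ i (F z) : ℝ))
    (fun i => by fun_prop) (fun i z => (χ i (F z)).2.1)
    ((hlf.preimage_continuous hFc).subset fun i z hz =>
      (hmem i z).1 (lt_of_le_of_ne (χ i (F z)).2.1 (Ne.symm hz)))
  simp only [hmem] at hmpos
  obtain ⟨u, huc, hu0, hulf, husum, husupp, huinv⟩ := exists_partition_subordinate hmc hm0 hmlf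
    fun x => (hshort x).imp fun i hi => (hmpos i x).2 hi
  have hset : ∀ i, {x | 0 < m i x} = {x | ∀ t, F (x, t) ∈ U i} := fun i =>
    Set.ext fun x => hmpos i x
  refine exists_lift_of_partition (F := ⟨F, hFc⟩) (u := u) hΛ hf hF h0 (fun i g b => ?_) huc hu0
    hulf husum (fun i g x => huinv _ _ (fun j => hminv _ _ (fun k s => ?_) j) i) (fun i => ?_)
    fun i => (husupp i).trans_eq (hset i)
  · simp only [hχ, mem_ofPred_eq, hχg]
  · simp only [hF.map_smul, hχg]
  · exact hset i ▸ isOpen_lt continuous_const (hmc i)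

/-- The part of the homotopy `F` over the times from `n δ` to `(n + 1) δ`. -/
noncomputable def timeSlice (F : X × I → B) (δ : X → ℝ) (n : ℕ) (z : X × I) : B :=
  F (z.1, projIcc 0 1 zero_le_one ((n + z.2) * δ z.1))

/-- Lifts of consecutive time slices of a homotopy can be put together. -/
theorem exists_lift_of_timeSlice [SMul G E] [SMul G X] {p : E → B}
    {F : X × I → B} {δ : X → ℝ} (hδc : Continuous δ) (hδ : ∀ x, 0 < δ x)
    (hδg : ∀ (g : G) x, δ (g • x) = δ x) (L : ℕ → X × I → E) (hL : ∀ n, IsGHomotopy G (L n))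
    (hLF : ∀ n z, p (L n z) = timeSlice F δ n z) (hLL : ∀ n x, L (n + 1) (x, 0) = L n (x, 1)) :
    ∃ L' : X × I → E, IsGHomotopy G L' ∧ (∀ z, p (L' z) = F z) ∧ ∀ x, L' (x, 0) = L 0 (x, 0) := by
  have hproj := continuous_projIcc (a := (0 : ℝ)) (b := 1) (h := zero_le_one)
  let piece : ℕ → X × I → E := fun n z => L n (z.1, projIcc 0 1 zero_le_one (z.2 / δ z.1 - n))
  let idx : X × I → ℕ := fun z => ⌊(z.2 : ℝ) / δ z.1⌋₊
  -- `idx` is discontinuous, so continuity is checked on the closed strips `C n`, which form a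
  -- locally finite cover.
  let C : ℕ → Set (X × I) := fun n => {z | n * δ z.1 ≤ z.2 ∧ (z.2 : ℝ) ≤ (n + 1) * δ z.1}
  have hpc : ∀ n, Continuous (piece n) := fun n => by
    have := (hL n).continuous
    have hd : Continuous fun z : X × I => (z.2 : ℝ) / δ z.1 :=
      Continuous.div (by fun_prop) (by fun_prop) fun z => (hδ z.1).ne'
    fun_prop
  have hnn : ∀ z : X × I, 0 ≤ (z.2 : ℝ) / δ z.1 := fun z => div_nonneg z.2.2.1 (hδ z.1).le
  have heq : ∀ n, ∀ z ∈ C n, piece (idx z) z = piece n z := by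
    rintro n z ⟨h1, h2⟩
    have h1' := (le_div_iff₀ (hδ z.1)).2 h1
    rcases h2.lt_or_eq with h | h
    · have : idx z = n :=
        (Nat.floor_eq_iff (hnn z)).2 ⟨h1', (div_lt_iff₀ (hδ z.1)).2 h⟩
      rw [this]
    -- On the upper edge of the strip the floor is already `n + 1`: piece `n + 1` at its start must
    -- match piece `n` at its end.
    · have h' : (z.2 : ℝ) / δ z.1 = n + 1 := by rw [h, mul_div_cancel_right₀ _ (hδ z.1).ne']
      have : idx z = n + 1 := by
        simp only [idx, h']
        exact_mod_cast Nat.floor_natCast (n + 1)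
      rw [this]
      simp only [piece, h']
      rw [projIcc_of_le_left _ (by simp), projIcc_of_right_le _ (by simp)]
      exact hLL n z.1
  have hidx : ∀ z, z ∈ C (idx z) := fun z =>
    ⟨(le_div_iff₀ (hδ z.1)).1 (Nat.floor_le (hnn z)),
      (div_le_iff₀ (hδ z.1)).1 (Nat.lt_floor_add_one _).le⟩
  have hClf : LocallyFinite C := by
    rintro ⟨x, t⟩
    -- Where `δ` exceeds `δ x / 2`, the bound `n * δ z.1 ≤ 1` leaves only `n ≤ 2 / δ x`.
    refine ⟨{z | δ x / 2 < δ z.1}, (isOpen_lt continuous_const (by fun_prop)).mem_nhds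
      (half_lt_self (hδ x)), (Set.finite_Iic ⌊2 / δ x⌋₊).subset ?_⟩
    rintro n ⟨z, ⟨h1, -⟩, h2⟩
    refine Nat.le_floor ((le_div_iff₀ (hδ x)).2 ?_)
    have h3 : (n : ℝ) * (δ x / 2) ≤ n * δ z.1 :=
      mul_le_mul_of_nonneg_left (le_of_lt h2) (Nat.cast_nonneg n)
    have h4 : (z.2 : ℝ) ≤ 1 := z.2.2.2
    linarith
  refine ⟨fun z => piece (idx z) z, ⟨?_, fun g x t => ?_⟩, fun z => ?_, fun x => ?_⟩
  · refine hClf.continuous (iUnion_eq_univ_iff.2 fun z => ⟨_, hidx z⟩) (fun n => ?_) fun n =>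
      (hpc n).continuousOn.congr (heq n)
    have h1 : IsClosed {z : X × I | n * δ z.1 ≤ z.2} := isClosed_le (by fun_prop) (by fun_prop)
    have h2 : IsClosed {z : X × I | (z.2 : ℝ) ≤ (n + 1) * δ z.1} :=
      isClosed_le (by fun_prop) (by fun_prop)
    exact h1.inter h2
  · simp only [piece, idx, hδg, (hL _).map_smul]
  · obtain ⟨h1, h2⟩ := hidx z
    have hδz := hδ z.1
    have h1' := (le_div_iff₀ hδz).2 h1
    have h2' := (div_le_iff₀ hδz).2 h2
    simp only [piece, hLF, timeSlice]
    rw [projIcc_of_mem _ (show (z.2 : ℝ) / δ z.1 - idx z ∈ Icc (0 : ℝ) 1 from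
      ⟨by linarith, by linarith⟩)]
    simp only [add_sub_cancel, div_mul_cancel₀ _ hδz.ne', projIcc_val]
  · simp [piece, idx]

end Concatenation

/-! ### The local-to-global theorem -/

/-- The universe of the test spaces is `max uE uB` in the hypothesis and arbitrary in the
conclusion, which is at least as strong as having all universes in both. -/
theorem theorem6 {G : Type uG} [Group G] [TopologicalSpace G] [IsTopologicalGroup G]
    [CompactSpace G]
    {E : Type uE} [TopologicalSpace E] [MulAction G E] [ContinuousSMul G E]
    {B : Type uB} [TopologicalSpace B] [MulAction G B] [ContinuousSMul G B]
    (p : E → B) (hp : IsGMap G p)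
    {ι : Type uι} (U : ι → SubMulAction G B)
    (hU : IsNormalGCover U) (hfin : LocallyFinite fun i => (U i : Set B))
    (hfib : ∀ i, IsHurewiczGFibration.{max uE uB} G (restrictOver hp (U i))) :
    IsHurewiczGFibration.{w} G p := by
  refine ⟨hp, fun X _ _ _ f F hf hF h0 => ?_⟩
  choose Λ hΛ using fun i => (hfib i).exists_isLiftingFunction
  choose χ hχg hχ using hU.exists_char
  have hFc := hF.continuous
  have hproj := continuous_projIcc (a := (0 : ℝ)) (b := 1) (h := zero_le_one)
  have hmem : ∀ i z, (0 : ℝ) < χ i (F z) ↔ F z ∈ (U i : Set B) := fun i z => by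
    rw [hχ, mem_ofPred_eq, ← unitInterval.pos_iff_ne_zero]
    exact Iff.rfl
  obtain ⟨δ, hδc, hδ, hδU, hδinv⟩ := exists_continuous_lebesgue
    (ψ := fun i z => (χ i (F z) : ℝ)) (fun i => by fun_prop) (fun i z => (χ i (F z)).2.1)
    ((hfin.preimage_continuous hFc).subset fun i z hz =>
      (hmem i z).1 (lt_of_le_of_ne (χ i (F z)).2.1 (Ne.symm hz)))
    fun z => (hU.covers (F z)).imp fun i hi => (hmem i z).2 hi
  simp only [hmem] at hδU
  have hδg : ∀ (g : G) x, δ (g • x) = δ x := fun g x =>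
    hδinv _ _ fun i t => by simp only [hF.map_smul, hχg]
  have hslice : ∀ n, IsGHomotopy G (timeSlice F δ n) := fun n =>
    ⟨by unfold timeSlice; fun_prop, fun g x t => by simp only [timeSlice, hδg, hF.map_smul]⟩
  have hshort : ∀ n x, ∃ i, ∀ t, timeSlice F δ n (x, t) ∈ (U i : Set B) := fun n x => by
    have hn : 0 ≤ n * δ x := mul_nonneg (Nat.cast_nonneg n) (hδ x).le
    obtain ⟨i, hi⟩ := hδU x (projIcc 0 1 zero_le_one (n * δ x))
    refine ⟨i, fun t => ?_⟩
    have ht0 : 0 ≤ t * δ x := mul_nonneg t.2.1 (hδ x).le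
    have h := hi (t * δ x) ht0 (mul_le_of_le_one_left (hδ x).le t.2.2)
    convert h using 2
    simp only [timeSlice, add_mul]
    -- If `n * δ x ≥ 1`, clamping makes the slice constant at time 1.
    rcases le_total (n * δ x) 1 with h1 | h1
    · rw [projIcc_of_mem _ ⟨hn, h1⟩]
    · rw [projIcc_of_right_le _ h1, projIcc_of_right_le _ (by linarith),
        projIcc_of_right_le _ (by linarith)]
  have hstep : ∀ n (f : X → E), IsGMap G f → (∀ x, timeSlice F δ n (x, 0) = p (f x)) →
      ∃ L : X × I → E, IsGHomotopy G L ∧ (∀ z, p (L z) = timeSlice F δ n z) ∧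
        ∀ x, L (x, 0) = f x := fun n f hf h0 =>
    exists_lift_of_short hΛ hχg hχ hfin hf (hslice n) h0 (hshort n)
  have : Nonempty (X × I → E) := ⟨fun z => f z.1⟩
  choose! L hL hLp hL0 using hstep
  -- The initial map of slice `n + 1` is the end of the lift of slice `n`.
  let fs : ℕ → X → E := fun n => n.rec f fun n f' x => L n f' (x, 1)
  have hfs : ∀ n, IsGMap G (fs n) ∧ ∀ x, timeSlice F δ n (x, 0) = p (fs n x) := fun n => by
    induction n with
    | zero =>
      refine ⟨hf, fun x => ?_⟩
      refine Eq.trans ?_ (h0 x)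
      simp [timeSlice]
    | succ n ih =>
      have hLn := hL n _ ih.1 ih.2
      have hLc := hLn.continuous
      refine ⟨⟨by change Continuous fun x => L n (fs n) (x, 1); fun_prop,
        fun g x => hLn.map_smul g x 1⟩, fun x => ?_⟩
      refine Eq.trans ?_ (hLp n _ ih.1 ih.2 (x, 1)).symm
      simp [timeSlice]
  obtain ⟨L', hL', hL'p, hL'0⟩ := exists_lift_of_timeSlice (p := p) (F := F) hδc hδ hδg
    (fun n => L n (fs n)) (fun n => hL n _ (hfs n).1 (hfs n).2)
    (fun n => hLp n _ (hfs n).1 (hfs n).2)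
    (fun n x => hL0 (n + 1) _ (hfs (n + 1)).1 (hfs (n + 1)).2 x)
  exact ⟨L', hL', hL'p, fun x => (hL'0 x).trans (hL0 0 _ (hfs 0).1 (hfs 0).2 x)⟩
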